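/- A subset $E$ of a topological space $X$ is \emph{resolvable} if there is a decreasing transfinite sequence $\langle F_\xi\rangle$ of closed subsets of $X$ such that $E=\bigcup_{\xi\text{ even}} (F_\xi\setminus F_{\xi+1})$, where the sequence is indexed from $0$ and $0$ and limit ordinals count as even. A space is \emph{completely Baire} if each of its closed subspaces is a Baire space. Theorem. Let $X$ be a metrizable completely Baire space, $Y$ a regular space (the $T_1$ axiom is not needed), and $f\colon X\to Y$ a mapping. Then the following conditions are equivalent: (i) $f$ is resolvable-measurable, i.e. $f^{-1}(U)$ is a resolvable subset of $X$ for every open $U\subset Y$; (ii) $f$ is piecewise continuous, i.e. $X$ can be covered by a sequence $X_0,X_1,\ldots$ of closed sets such that the restriction $f\upharpoonright X_n$ is continuous for every $n\in\omega$; (iii) $f$ is $\mathbf{\Pi}^0_2$-measurable, i.e. $f^{-1}(U)$ is a $G_\delta$-set in $X$ for every open $U\subset Y$. -/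

import Mathlib

open Topology Ordinal

universe u v

/-- A subset `E` of `X` is *resolvable* if, for some decreasing transfinite sequence `F` of closed
sets, `E` is the union of the differences `F ξ \ F (ξ + 1)` over even ordinals `ξ` (limit ordinals,
and `0`, are even) below some bound. The even ordinals are exactly those of the form `2 * η`
(in Mathlib's convention `2 * ω = ω`). -/
def IsResolvableSet {X : Type u} [TopologicalSpace X] (E : Set X) : Prop :=
  ∃ (α : Ordinal.{u}) (F : Ordinal.{u} → Set X),
    (∀ ξ, IsClosed (F ξ)) ∧ Antitone F ∧
      E = ⋃ η ∈ Set.Iio α, F (2 * η) \ F (2 * η + 1)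

/-- Preimages of open sets are resolvable. -/
def ResolvableMeasurable {X : Type u} {Y : Type v} [TopologicalSpace X] [TopologicalSpace Y]
    (f : X → Y) : Prop :=
  ∀ U : Set Y, IsOpen U → IsResolvableSet (f ⁻¹' U)

/-- `X` is covered by a sequence of closed sets on each of which `f` restricts to a continuous
map. -/
def PiecewiseContinuous {X : Type u} {Y : Type v} [TopologicalSpace X] [TopologicalSpace Y]
    (f : X → Y) : Prop :=
  ∃ C : ℕ → Set X, (∀ n, IsClosed (C n)) ∧ (⋃ n, C n) = Set.univ ∧ ∀ n, ContinuousOn f (C n)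

/-- `Π⁰₂`-measurability: preimages of open sets are `G_δ`. -/
def PiTwoMeasurable {X : Type u} {Y : Type v} [TopologicalSpace X] [TopologicalSpace Y]
    (f : X → Y) : Prop :=
  ∀ U : Set Y, IsOpen U → IsGδ (f ⁻¹' U)

/-- Every closed subspace of `X` is a Baire space. -/
def CompletelyBaire (X : Type u) [TopologicalSpace X] : Prop :=
  ∀ C : Set X, IsClosed C → BaireSpace C

open Set Metric

/-! ### Uniformly separated families in metric spaces -/

/-! The implications run (i) ⇒ (iii) ⇒ (ii) ⇒ (i).

(i) ⇒ (iii): membership in a resolvable set depends only on the first `ξ` with `x ∉ F ξ`. Points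
with different exit indices, kept `1 / (n + 1)` away from the `F ξ` they leave, form separated
closed families, so the complement is an Fσ plus the closed set `⋂ ξ, F ξ` (`IsResolvableSet.isGδ`).

(ii) ⇒ (i): by Baire category some `C n` has interior in any given nonempty closed `A`; there `f` is
continuous, so `f ⁻¹' U` contains or misses a relatively open piece of `A`. Alternating closures of
traces of `E` and `Eᶜ` then shrink to `∅` and resolve `E`.

(iii) ⇒ (ii): if no countable closed cover works, points are chosen in two colours, near each other
at every scale, with images in disjoint open sets. On the closure `K` of these points both preimages
are dense Gδ sets, contradicting Baire. The choice can continue because non-coverability survives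
near every chosen point outside the part of `Y` already used
(`exists_irreducibleAt_diff_preimage_of_finset`). -/

theorem locallyFinite_of_separated {X : Type*} [PseudoMetricSpace X] {ι : Type*} {D : ι → Set X}
    {ε : ℝ} (hε : 0 < ε)
    (hD : ∀ i j, i ≠ j → ∀ x ∈ D i, ∀ y ∈ D j, ε ≤ dist x y) : LocallyFinite D := by
  intro x
  refine ⟨ball x (ε / 2), ball_mem_nhds x (by positivity), Set.Subsingleton.finite ?_⟩
  rintro i ⟨a, ha, hax⟩ j ⟨b, hb, hbx⟩
  by_contra hij
  have h := hD i j hij a ha b hb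
  have := dist_triangle_right a b x
  rw [mem_ball] at hax hbx
  linarith

theorem le_dist_of_notMem_thickening {X : Type*} [PseudoMetricSpace X] {s : Set X} {r : ℝ}
    {x y : X} (hx : x ∉ thickening r s) (hy : y ∈ s) : r ≤ dist x y := by
  by_contra! h
  exact hx (mem_thickening_iff.2 ⟨y, hy, h⟩)

theorem exists_notMem_thickening {X : Type*} [PseudoMetricSpace X] {s : Set X} (hs : IsClosed s)
    {x : X} (hx : x ∉ s) : ∃ n : ℕ, x ∉ thickening (1 / ((n : ℝ) + 1)) s := by
  obtain ⟨ε, hε, h⟩ := Metric.isOpen_iff.1 hs.isOpen_compl x hx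
  obtain ⟨n, hn⟩ := exists_nat_one_div_lt hε
  refine ⟨n, fun hx' => ?_⟩
  obtain ⟨y, hy, hxy⟩ := mem_thickening_iff.1 hx'
  refine h (mem_ball.2 ?_) hy
  rw [dist_comm]
  exact hxy.trans hn

theorem notMem_of_notMem_thickening {X : Type*} [PseudoMetricSpace X] {s : Set X} {n : ℕ} {x : X}
    (hx : x ∉ thickening (1 / ((n : ℝ) + 1)) s) : x ∉ s :=
  fun h => hx (self_subset_thickening Nat.one_div_pos_of_nat s h)

/-! ### Resolvable sets -/

theorem IsResolvableSet.isGδ {X : Type u} [PseudoMetricSpace X] {E : Set X}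
    (hE : IsResolvableSet E) : IsGδ E := by
  obtain ⟨α, F, hF, hanti, rfl⟩ := hE
  -- Points of the resolvable set are those whose first exit index is `2 * η + 1` with `η < α`; `ι`
  -- collects all other possible exit indices.
  let ι := {ξ : Ordinal.{u} // ¬ ∃ η < α, ξ = 2 * η + 1}
  let D : ℕ → ι → Set X := fun n ξ =>
    (⋂ ζ ∈ Set.Iio ξ.1, F ζ) ∩ (thickening (1 / ((n : ℝ) + 1)) (F ξ.1))ᶜ
  have hDclosed : ∀ n ξ, IsClosed (D n ξ) := fun n ξ =>
    (isClosed_biInter fun ζ _ => hF ζ).inter isOpen_thickening.isClosed_compl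
  have hsep : ∀ n (ξ ξ' : ι), ξ.1 < ξ'.1 → ∀ x ∈ D n ξ, ∀ y ∈ D n ξ',
      1 / ((n : ℝ) + 1) ≤ dist x y := fun n ξ ξ' h x hx y hy =>
    le_dist_of_notMem_thickening hx.2 (mem_iInter₂.1 hy.1 ξ.1 h)
  have hlf : ∀ n, LocallyFinite (D n) := fun n => by
    refine locallyFinite_of_separated (Nat.one_div_pos_of_nat (n := n)) fun ξ ξ' hne x hx y hy => ?_
    rcases lt_or_gt_of_ne (Subtype.coe_ne_coe.2 hne) with h | h
    · exact hsep n ξ ξ' h x hx y hy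
    · rw [dist_comm]
      exact hsep n ξ' ξ h y hy x hx
  have key : (⋃ η ∈ Set.Iio α, F (2 * η) \ F (2 * η + 1)) =
      (⋂ ξ, F ξ)ᶜ ∩ ⋂ n, (⋃ ξ, D n ξ)ᶜ := by
    ext x
    simp only [mem_iUnion, mem_inter_iff, mem_compl_iff, mem_iInter, Set.mem_Iio, exists_prop,
      mem_sdiff]
    constructor
    · rintro ⟨η, hη, hx, hx'⟩
      refine ⟨fun h => hx' (h _), ?_⟩
      rintro n ⟨ξ, h1, h2⟩
      have hxξ : x ∉ F ξ.1 := notMem_of_notMem_thickening h2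
      have h3 : 2 * η < ξ.1 := by
        by_contra! h
        exact hxξ (hanti h hx)
      have h4 : ξ.1 ≤ 2 * η + 1 := by
        by_contra! h
        exact hx' (mem_iInter₂.1 h1 _ h)
      exact ξ.2 ⟨η, hη, le_antisymm h4 (Order.add_one_le_of_lt h3)⟩
    · rintro ⟨h1, h2⟩
      by_contra hx
      push Not at h1
      obtain ⟨ξ, hξ, hmin⟩ := WellFounded.has_min (wellFounded_lt (α := Ordinal.{u}))
        {ξ | x ∉ F ξ} h1
      have hlt : ∀ ζ < ξ, x ∈ F ζ := fun ζ hζ => by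
        by_contra h
        exact hmin ζ h hζ
      have hS : ¬ ∃ η < α, ξ = 2 * η + 1 := by
        rintro ⟨η, hη, rfl⟩
        exact hx ⟨η, hη, hlt _ (Order.lt_add_one_iff.2 le_rfl), hξ⟩
      obtain ⟨n, hn⟩ := exists_notMem_thickening (hF ξ) hξ
      exact h2 n ⟨⟨ξ, hS⟩, mem_iInter₂.2 hlt, hn⟩
  rw [key]
  exact (isClosed_iInter hF).isOpen_compl.isGδ.inter
    (IsGδ.iInter fun n => ((hlf n).isClosed_iUnion (hDclosed n)).isOpen_compl.isGδ)

/-- The transfinite sequence obtained by taking closures of the traces of `Eᶜ` (at even stages) and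
`E` (at odd stages), with intersections at limits. -/
noncomputable def resolvingSeq {X : Type u} [TopologicalSpace X] (E : Set X) :
    Ordinal.{u} → Set X :=
  WellFoundedLT.fix fun ξ G =>
    ⋂ ζ : Set.Iio ξ, closure (G ζ.1 ζ.2 ∩ {x | x ∈ E ↔ ¬ ∃ η : Ordinal.{u}, ζ.1 = 2 * η})

theorem resolvingSeq_eq {X : Type u} [TopologicalSpace X] (E : Set X) (ξ : Ordinal.{u}) :
    resolvingSeq E ξ = ⋂ ζ : Set.Iio ξ,
      closure (resolvingSeq E ζ.1 ∩ {x | x ∈ E ↔ ¬ ∃ η : Ordinal.{u}, ζ.1 = 2 * η}) :=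
  WellFoundedLT.fix_eq _ ξ

theorem isClosed_resolvingSeq {X : Type u} [TopologicalSpace X] (E : Set X) (ξ : Ordinal.{u}) :
    IsClosed (resolvingSeq E ξ) := by
  rw [resolvingSeq_eq]
  exact isClosed_iInter fun _ => isClosed_closure

theorem antitone_resolvingSeq {X : Type u} [TopologicalSpace X] (E : Set X) :
    Antitone (resolvingSeq E) := by
  intro ξ ξ' h x hx
  rw [resolvingSeq_eq, mem_iInter] at hx ⊢
  exact fun ζ => hx ⟨ζ.1, ζ.2.trans_le h⟩

theorem resolvingSeq_add_one {X : Type u} [TopologicalSpace X] (E : Set X) (ξ : Ordinal.{u}) :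
    resolvingSeq E (ξ + 1) =
      closure (resolvingSeq E ξ ∩ {x | x ∈ E ↔ ¬ ∃ η : Ordinal.{u}, ξ = 2 * η}) := by
  have hlt : ξ < ξ + 1 := Order.lt_add_one_iff.2 le_rfl
  apply Subset.antisymm
  · intro x hx
    rw [resolvingSeq_eq, mem_iInter] at hx
    exact hx ⟨ξ, hlt⟩
  · intro x hx
    rw [resolvingSeq_eq, mem_iInter]
    rintro ⟨ζ, hζ⟩
    rcases (Order.lt_add_one_iff.1 (Set.mem_Iio.1 hζ)).eq_or_lt with rfl | h
    · exact hx
    · have hx' : x ∈ resolvingSeq E ξ :=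
        closure_minimal inter_subset_left (isClosed_resolvingSeq E ξ) hx
      rw [resolvingSeq_eq, mem_iInter] at hx'
      exact hx' ⟨ζ, h⟩

theorem not_exists_two_mul_add_one_eq (η : Ordinal.{u}) :
    ¬ ∃ η' : Ordinal.{u}, 2 * η + 1 = 2 * η' := by
  rintro ⟨η', h⟩
  have h1 : η < η' := by
    by_contra! h'
    have h2 : 2 * η' ≤ 2 * η := mul_le_mul_right h' 2
    rw [← h] at h2
    exact absurd (Order.lt_add_one_iff.2 (le_refl (2 * η))) h2.not_gt
  have h3 : 2 * (η + 1) ≤ 2 * η' := mul_le_mul_right (Order.add_one_le_of_lt h1) 2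
  rw [← h, mul_add, mul_one, ← one_add_one_eq_two, ← add_assoc] at h3
  exact absurd (Order.lt_add_one_iff.2 (le_refl _)) h3.not_gt

/-- Once the alternating sequence is constant over an even stage and the two steps after it, both
`E` and `Eᶜ` are dense in that term, which the hypothesis permits only for `∅`. -/
theorem isResolvableSet_of_forall_isClosed {X : Type u} [TopologicalSpace X] {E : Set X}
    (hE : ∀ A : Set X, IsClosed A → A.Nonempty →
      ∃ O, IsOpen O ∧ (O ∩ A).Nonempty ∧ (O ∩ A ⊆ E ∨ O ∩ A ⊆ Eᶜ)) :
    IsResolvableSet E := by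
  have hodd : ∀ η : Ordinal.{u},
      resolvingSeq E (2 * η + 1) = closure (resolvingSeq E (2 * η) \ E) := by
    intro η
    rw [resolvingSeq_add_one]
    congr 1
    ext x
    simp
  have heven : ∀ η : Ordinal.{u},
      resolvingSeq E (2 * (η + 1)) = closure (resolvingSeq E (2 * η + 1) ∩ E) := by
    intro η
    have h2 : 2 * (η + 1) = 2 * η + 1 + 1 := by
      rw [mul_add, mul_one, ← one_add_one_eq_two, ← add_assoc]
    rw [h2, resolvingSeq_add_one]
    congr 1
    ext x
    have := not_exists_two_mul_add_one_eq η
    simp only [this, mem_inter_iff, mem_ofPred_eq, not_false_eq_true, iff_true]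
  have hmono : Monotone fun η : Ordinal.{u} => 2 * η := fun a b h => mul_le_mul_right h 2
  obtain ⟨α, hα⟩ : ∃ α : Ordinal.{u}, resolvingSeq E (2 * α) = ∅ := by
    -- The ordinals do not inject into `Set X`, so two even terms coincide, and by monotonicity all
    -- terms between them.
    have hni := not_injective_of_ordinal fun η : Ordinal.{u} => resolvingSeq E (2 * η)
    obtain ⟨η, η', heq, hlt⟩ : ∃ η η' : Ordinal.{u},
        resolvingSeq E (2 * η) = resolvingSeq E (2 * η') ∧ η < η' := by
      simp only [Function.Injective, not_forall] at hni
      obtain ⟨a, b, h, hne⟩ := hni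
      rcases lt_or_gt_of_ne hne with h' | h'
      exacts [⟨a, b, h, h'⟩, ⟨b, a, h.symm, h'⟩]
    have h2 : resolvingSeq E (2 * η) ⊆ resolvingSeq E (2 * (η + 1)) := by
      rw [heq]
      exact antitone_resolvingSeq E (hmono (Order.add_one_le_of_lt hlt))
    have h1 : resolvingSeq E (2 * η) ⊆ resolvingSeq E (2 * η + 1) := by
      refine h2.trans ?_
      rw [heven]
      exact closure_minimal inter_subset_left (isClosed_resolvingSeq E _)
    have h0 : resolvingSeq E (2 * η + 1) ⊆ resolvingSeq E (2 * η) :=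
      antitone_resolvingSeq E (Order.lt_add_one_iff.2 le_rfl).le
    have h3 : resolvingSeq E (2 * η + 1) = resolvingSeq E (2 * η) := h0.antisymm h1
    rw [heven, h3] at h2
    rw [hodd] at h1
    refine ⟨η, ?_⟩
    by_contra hne
    obtain ⟨O, hO, ⟨x, hxO, hx⟩, h | h⟩ :=
      hE _ (isClosed_resolvingSeq E _) (nonempty_iff_ne_empty.2 hne)
    · obtain ⟨y, hyO, hy, hyE⟩ := mem_closure_iff.1 (h1 hx) O hO hxO
      exact hyE (h ⟨hyO, hy⟩)
    · obtain ⟨y, hyO, hy, hyE⟩ := mem_closure_iff.1 (h2 hx) O hO hxO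
      exact h ⟨hyO, hy⟩ hyE
  refine ⟨α, resolvingSeq E, isClosed_resolvingSeq E, antitone_resolvingSeq E, ?_⟩
  ext x
  simp only [mem_iUnion, Set.mem_Iio, exists_prop, mem_sdiff]
  constructor
  · intro hx
    have hne : {ξ | x ∉ resolvingSeq E ξ}.Nonempty := ⟨2 * α, by simp [hα]⟩
    obtain ⟨ξ, hξ, hmin⟩ := WellFounded.has_min (wellFounded_lt (α := Ordinal.{u})) _ hne
    rw [mem_ofPred_eq, resolvingSeq_eq, mem_iInter, not_forall] at hξ
    obtain ⟨⟨ζ, hζ⟩, hxζ⟩ := hξ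
    have hxF : x ∈ resolvingSeq E ζ := by
      by_contra h
      exact hmin ζ h hζ
    by_cases hev : ∃ η : Ordinal.{u}, ζ = 2 * η
    · obtain ⟨η, rfl⟩ := hev
      refine ⟨η, ?_, hxF, ?_⟩
      · by_contra! h
        have := antitone_resolvingSeq E (hmono h) hxF
        simp [hα] at this
      · rwa [resolvingSeq_add_one]
    · exact (hxζ (subset_closure
        ⟨hxF, by simp only [mem_ofPred_eq, hx, hev, not_false_eq_true]⟩)).elim
  · rintro ⟨η, -, hx, hx'⟩
    by_contra hxE
    rw [hodd] at hx'
    exact hx' (subset_closure ⟨hx, hxE⟩)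

/-! ### Sets covered by countably many closed sets of continuity -/

/-- `S` is covered by countably many closed sets on each of which `f` is continuous. -/
def ContinuityCovered {X Y : Type*} [TopologicalSpace X] [TopologicalSpace Y]
    (f : X → Y) (S : Set X) : Prop :=
  ∃ C : ℕ → Set X, (∀ n, IsClosed (C n)) ∧ S ⊆ (⋃ n, C n) ∧ ∀ n, ContinuousOn f (C n)

namespace ContinuityCovered

variable {X Y : Type*} [TopologicalSpace X] [TopologicalSpace Y] {f : X → Y} {S T : Set X}

theorem mono (hT : ContinuityCovered f T) (h : S ⊆ T) : ContinuityCovered f S := by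
  obtain ⟨C, h1, h2, h3⟩ := hT
  exact ⟨C, h1, h.trans h2, h3⟩

theorem of_isClosed (hS : IsClosed S) (hf : ContinuousOn f S) : ContinuityCovered f S :=
  ⟨fun _ => S, fun _ => hS, fun _ hx => mem_iUnion.2 ⟨0, hx⟩, fun _ => hf⟩

theorem iUnion {ι : Type*} [Countable ι] {S : ι → Set X} (hS : ∀ i, ContinuityCovered f (S i)) :
    ContinuityCovered f (⋃ i, S i) := by
  rcases isEmpty_or_nonempty ι with _ | _
  · rw [iUnion_of_empty]
    exact of_isClosed isClosed_empty (continuousOn_empty f)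
  choose C h1 h2 h3 using hS
  obtain ⟨e, he⟩ := exists_surjective_nat (ι × ℕ)
  refine ⟨fun n => C (e n).1 (e n).2, fun n => h1 _ _, ?_, fun n => h3 _ _⟩
  refine iUnion_subset fun i x hx => ?_
  obtain ⟨n, hn⟩ := mem_iUnion.1 (h2 i hx)
  obtain ⟨k, hk⟩ := he (i, n)
  exact mem_iUnion.2 ⟨k, by rwa [hk]⟩

theorem union (hS : ContinuityCovered f S) (hT : ContinuityCovered f T) :
    ContinuityCovered f (S ∪ T) := by
  rw [union_eq_iUnion]
  exact iUnion fun b => by cases b <;> assumption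

end ContinuityCovered

/-- Being covered by countably many closed sets of continuity is a local property. -/
theorem continuityCovered_of_locally {X Y : Type*} [PseudoMetricSpace X] [TopologicalSpace Y]
    {f : X → Y} {S : Set X}
    (hS : ∀ x ∈ S, ∃ O, IsOpen O ∧ x ∈ O ∧ ContinuityCovered f (O ∩ S)) :
    ContinuityCovered f S := by
  let ι := {O : Set X // IsOpen O ∧ ContinuityCovered f (O ∩ S)}
  choose C h1 h2 h3 using fun O : ι => O.2.2
  let r : ι → ι → Prop := WellOrderingRel
  -- As in Stone's proof of paracompactness: each point is assigned to the first `O` containing it,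
  -- and a margin from `Oᶜ` separates the pieces.
  let D : ℕ × ℕ → ι → Set X := fun p O =>
    (C O p.1 ∩ ⋂ O' : {O' : ι // r O' O}, (O'.1.1)ᶜ) ∩ (thickening (1 / ((p.2 : ℝ) + 1)) O.1ᶜ)ᶜ
  have hDclosed : ∀ p O, IsClosed (D p O) := fun p O =>
    ((h1 O p.1).inter (isClosed_iInter fun O' => O'.1.2.1.isClosed_compl)).inter
      isOpen_thickening.isClosed_compl
  have hsep : ∀ p (O O' : ι), r O O' → ∀ x ∈ D p O, ∀ y ∈ D p O',
      1 / ((p.2 : ℝ) + 1) ≤ dist x y := fun p O O' h x hx y hy =>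
    le_dist_of_notMem_thickening hx.2 (mem_iInter.1 hy.1.2 ⟨O, h⟩)
  have hlf : ∀ p, LocallyFinite (D p) := fun p => by
    refine locallyFinite_of_separated (Nat.one_div_pos_of_nat (n := p.2)) fun O O' hne x hx y hy => ?_
    rcases trichotomous_of r O O' with h | h | h
    · exact hsep p O O' h x hx y hy
    · exact absurd h hne
    · rw [dist_comm]
      exact hsep p O' O h y hy x hx
  refine (ContinuityCovered.iUnion fun p => ContinuityCovered.of_isClosed
    ((hlf p).isClosed_iUnion (hDclosed p)) ((hlf p).continuousOn_iUnion (hDclosed p)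
      fun O => (h3 O p.1).mono fun x hx => hx.1.1)).mono fun x hx => ?_
  obtain ⟨U, hU, hxU, hUS⟩ := hS x hx
  obtain ⟨O, hO, hmin⟩ := WellFounded.has_min (IsWellFounded.wf (r := r)) {O : ι | x ∈ O.1}
    ⟨⟨U, hU, hUS⟩, hxU⟩
  obtain ⟨n, hn⟩ := mem_iUnion.1 (h2 O ⟨hO, hx⟩)
  obtain ⟨m, hm⟩ := exists_notMem_thickening O.2.1.isClosed_compl (notMem_compl_iff.2 hO)
  exact mem_iUnion.2 ⟨(n, m), mem_iUnion.2 ⟨O,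
    ⟨hn, mem_iInter.2 fun O' h => hmin O'.1 h O'.2⟩, hm⟩⟩

/-! ### Irreducible points and their persistence -/

/-- `x` is a point at which `S` is not locally covered by countably many closed sets of continuity
of `f`. -/
def IrreducibleAt {X Y : Type*} [TopologicalSpace X] [TopologicalSpace Y]
    (f : X → Y) (x : X) (S : Set X) : Prop :=
  ∀ O, IsOpen O → x ∈ O → ¬ ContinuityCovered f (O ∩ S)

section Irreducible

variable {X Y : Type*} [PseudoMetricSpace X] [TopologicalSpace Y] {f : X → Y} {S T : Set X} {x : X}

theorem IrreducibleAt.mono (hx : IrreducibleAt f x S) (h : S ⊆ T) : IrreducibleAt f x T :=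
  fun O hO hxO hc => hx O hO hxO (hc.mono (inter_subset_inter_right O h))

theorem IrreducibleAt.not_continuityCovered (hx : IrreducibleAt f x S) : ¬ ContinuityCovered f S :=
  fun hc => hx univ isOpen_univ (mem_univ x) (hc.mono inter_subset_right)

theorem IrreducibleAt.or_of_union (hx : IrreducibleAt f x (S ∪ T)) :
    IrreducibleAt f x S ∨ IrreducibleAt f x T := by
  by_contra! h
  simp only [IrreducibleAt, not_forall, not_not] at h
  obtain ⟨⟨O, hO, hxO, hc⟩, O', hO', hxO', hc'⟩ := h
  refine hx (O ∩ O') (hO.inter hO') ⟨hxO, hxO'⟩ ((hc.union hc').mono ?_)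
  rintro y ⟨⟨hy, hy'⟩, hS | hT⟩
  exacts [Or.inl ⟨hy, hS⟩, Or.inr ⟨hy', hT⟩]

theorem exists_isOpen_closure_subset [RegularSpace Y] {y : Y} {U : Set Y} (hU : IsOpen U)
    (hy : y ∈ U) : ∃ V, IsOpen V ∧ y ∈ V ∧ closure V ⊆ U := by
  obtain ⟨F, hyF, hF, h⟩ := exists_mem_nhds_isClosed_subset (hU.mem_nhds hy)
  exact ⟨interior F, isOpen_interior, mem_interior_iff_mem_nhds.2 hyF,
    (closure_minimal interior_subset hF).trans h⟩

/-- A closed set that is not covered by countably many closed sets of continuity contains a point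
`x` at which it remains irreducible after removal of the preimage of a neighbourhood of `f x`. -/
theorem exists_irreducibleAt_diff_preimage [RegularSpace Y] (hS : IsClosed S)
    (hn : ¬ ContinuityCovered f S) :
    ∃ x ∈ S, ∃ U, IsOpen U ∧ f x ∈ U ∧ IrreducibleAt f x (S \ f ⁻¹' U) := by
  by_contra! hcon
  let R : Set X := ⋃₀ {O | IsOpen O ∧ ContinuityCovered f (O ∩ S)}
  have hR : IsOpen R := isOpen_sUnion fun O hO => hO.1
  have hirr : ∀ x ∉ R, IrreducibleAt f x S := fun x hx O hO hxO hc =>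
    hx (mem_sUnion.2 ⟨O, ⟨hO, hc⟩, hxO⟩)
  have hRS : ContinuityCovered f (R ∩ S) := by
    refine continuityCovered_of_locally fun x hx => ?_
    obtain ⟨O, ⟨hO, hc⟩, hxO⟩ := hx.1
    exact ⟨O, hO, hxO, hc.mono fun y hy => ⟨hy.1, hy.2.2⟩⟩
  -- A nearby `z ∈ S \ R` with `f z ∉ W` would have both `S \ f ⁻¹' V` and `S ∩ f ⁻¹' (closure V)`
  -- covered around it, hence `S` itself, against `z ∉ R`.
  have hcont : ContinuousOn f (S \ R) := by
    intro x hx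
    refine (nhds_basis_opens (f x)).tendsto_right_iff.2 fun W hW => ?_
    obtain ⟨V, hV, hxV, hVW⟩ := exists_isOpen_closure_subset hW.2 hW.1
    have h := hcon x hx.1 V hV hxV
    simp only [IrreducibleAt, not_forall, not_not] at h
    obtain ⟨O, hO, hxO, hc⟩ := h
    filter_upwards [mem_nhdsWithin_of_mem_nhds (hO.mem_nhds hxO), self_mem_nhdsWithin] with z hzO hz
    by_contra hzW
    have hz' := hcon z hz.1 (closure V)ᶜ isClosed_closure.isOpen_compl fun h => hzW (hVW h)
    simp only [IrreducibleAt, not_forall, not_not] at hz'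
    obtain ⟨O', hO', hzO', hc'⟩ := hz'
    refine hirr z hz.2 (O ∩ O') (hO.inter hO') ⟨hzO, hzO'⟩ ((hc.union hc').mono ?_)
    rintro y ⟨⟨hy, hy'⟩, hyS⟩
    by_cases hyV : f y ∈ V
    · exact Or.inr ⟨hy', hyS, fun h => h (subset_closure hyV)⟩
    · exact Or.inl ⟨hy, hyS, hyV⟩
  refine hn ((hRS.union (.of_isClosed (hS.sdiff hR) hcont)).mono fun x hx => ?_)
  by_cases h : x ∈ R
  exacts [Or.inl ⟨h, hx⟩, Or.inr ⟨hx, h⟩]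

/-- `S \ U` is a countable union of closed sets, and they cannot all be covered. -/
theorem exists_isClosed_subset_diff (hS : IsClosed S) {U : Set X} (hU : IsGδ U)
    (hn : ¬ ContinuityCovered f (S \ U)) :
    ∃ S₁ ⊆ S \ U, IsClosed S₁ ∧ ¬ ContinuityCovered f S₁ := by
  obtain ⟨O, hO, rfl⟩ := hU.eq_iInter_nat
  by_contra! h
  refine hn ((ContinuityCovered.iUnion fun n => h (S \ O n)
    (sdiff_subset_sdiff_right (iInter_subset O n)) (hS.sdiff (hO n))).mono ?_)
  rw [← sdiff_iInter]

/-- As in `exists_irreducibleAt_diff_preimage`, while finitely many further points stay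
irreducible. -/
theorem exists_irreducibleAt_diff_preimage_of_finset [RegularSpace Y]
    (hf : ∀ U : Set Y, IsOpen U → IsGδ (f ⁻¹' U)) (P : Finset X)
    (hP : ∀ p ∈ P, IrreducibleAt f p T) :
    ∀ S : Set X, IsClosed S → ¬ ContinuityCovered f S →
      ∃ x ∈ S, ∃ U, IsOpen U ∧ f x ∈ U ∧ IrreducibleAt f x (S \ f ⁻¹' U) ∧
        ∀ p ∈ P, IrreducibleAt f p (T \ f ⁻¹' U) := by
  classical
  induction P using Finset.induction_on with
  | empty =>
    intro S hS hn
    obtain ⟨x, hx, U, hU, hxU, hirr⟩ := exists_irreducibleAt_diff_preimage hS hn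
    exact ⟨x, hx, U, hU, hxU, hirr, by simp⟩
  | insert p P _ ih =>
    intro S hS hn
    have ih := ih fun q hq => hP q (Finset.mem_insert_of_mem hq)
    obtain ⟨x, hx, U, hU, hxU, hirr, hPU⟩ := ih S hS hn
    obtain ⟨V, hV, hxV, hVU⟩ := exists_isOpen_closure_subset hU hxU
    have hVU' : f ⁻¹' V ⊆ f ⁻¹' U := preimage_mono (subset_closure.trans hVU)
    by_cases hp : IrreducibleAt f p (T \ f ⁻¹' V)
    · refine ⟨x, hx, V, hV, hxV, hirr.mono (sdiff_subset_sdiff_right hVU'), fun q hq => ?_⟩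
      rcases Finset.mem_insert.1 hq with rfl | hq
      · exact hp
      · exact (hPU q hq).mono (sdiff_subset_sdiff_right hVU')
    -- Since `T \ f ⁻¹' V` is covered near `p`, the irreducibility at `p` sits in `f ⁻¹' V`. It is
    -- undisturbed by any neighbourhood missing `V`, so a new point is sought with image outside `U
    -- ⊇ closure V`.
    obtain ⟨S₁, hS₁S, hS₁, hn₁⟩ :=
      exists_isClosed_subset_diff hS (hf U hU) hirr.not_continuityCovered
    obtain ⟨x₁, hx₁, U₁, hU₁, hxU₁, hirr₁, hPU₁⟩ := ih S₁ hS₁ hn₁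
    have hsub : f ⁻¹' (U₁ \ closure V) ⊆ f ⁻¹' U₁ := preimage_mono sdiff_subset
    refine ⟨x₁, (hS₁S hx₁).1, U₁ \ closure V, hU₁.sdiff isClosed_closure,
      ⟨hxU₁, fun h => (hS₁S hx₁).2 (hVU h)⟩,
      hirr₁.mono (sdiff_subset_sdiff (hS₁S.trans sdiff_subset) hsub), fun q hq => ?_⟩
    rcases Finset.mem_insert.1 hq with rfl | hq
    · refine ((hP q (Finset.mem_insert_self q P)).mono fun y hy => ?_).or_of_union.resolve_left hp
      by_cases hyV : f y ∈ V
      · exact Or.inr ⟨hy, fun h => h.2 (subset_closure hyV)⟩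
      · exact Or.inl ⟨hy, hyV⟩
    · exact (hPU₁ q hq).mono (sdiff_subset_sdiff_right hsub)

end Irreducible

/-! ### Two disjoint open sets whose preimages are dense in a closed set -/

/-- A finite stage of the construction: finite sets `P false`, `P true` of points, mapped by `f`
into disjoint open sets `V false`, `V true`, whose closures lie in an open set `W` such that `f`
remains irreducible outside of `f ⁻¹' W` at all chosen points. -/
structure SplittingStage {X Y : Type*} [TopologicalSpace X] [TopologicalSpace Y]
    (f : X → Y) where
  P : Bool → Finset X
  V : Bool → Set Y
  W : Set Y
  isOpen_V : ∀ c, IsOpen (V c)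
  isOpen_W : IsOpen W
  mapsTo : ∀ c, ∀ x ∈ P c, f x ∈ V c
  disjoint : Disjoint (V false) (V true)
  closure_subset : ∀ c, closure (V c) ⊆ W
  irreducible : ∀ c, ∀ x ∈ P c, IrreducibleAt f x (f ⁻¹' W)ᶜ

namespace SplittingStage

variable {X Y : Type*} [PseudoMetricSpace X] [TopologicalSpace Y] {f : X → Y}

/-- `t` extends `s`. -/
instance : Preorder (SplittingStage f) where
  le s t := ∀ c, s.P c ⊆ t.P c ∧ s.V c ⊆ t.V c
  le_refl s c := ⟨subset_rfl, subset_rfl⟩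
  le_trans s t r hst htr c := ⟨(hst c).1.trans (htr c).1, (hst c).2.trans (htr c).2⟩

theorem exists_extend [RegularSpace Y] (hf : ∀ U : Set Y, IsOpen U → IsGδ (f ⁻¹' U))
    (s : SplittingStage f) (c : Bool) {S : Set X} (hS : IsClosed S)
    (hn : ¬ ContinuityCovered f (S \ f ⁻¹' s.W)) : ∃ t, s ≤ t ∧ ∃ x ∈ t.P c, x ∈ S := by
  classical
  obtain ⟨S₁, hS₁S, hS₁, hn₁⟩ := exists_isClosed_subset_diff hS (hf _ s.isOpen_W) hn
  obtain ⟨x, hx, U, hU, hxU, hirr, hPU⟩ := exists_irreducibleAt_diff_preimage_of_finset hf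
    (s.P false ∪ s.P true) (T := (f ⁻¹' s.W)ᶜ)
    (fun p hp => (Finset.mem_union.1 hp).elim (s.irreducible _ p) (s.irreducible _ p)) S₁ hS₁ hn₁
  have hxW : f x ∉ s.W := (hS₁S hx).2
  -- Because `W` contains the closures of both old open sets and `f x ∉ W`, the new neighbourhood
  -- can avoid both, whichever colour it joins.
  obtain ⟨V, hV, hxV, hVU⟩ := exists_isOpen_closure_subset
    (U := (U \ closure (s.V false)) \ closure (s.V true))
    ((hU.sdiff isClosed_closure).sdiff isClosed_closure)
    ⟨⟨hxU, fun h => hxW (s.closure_subset _ h)⟩, fun h => hxW (s.closure_subset _ h)⟩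
  have hdisj : ∀ d, Disjoint V (s.V d) := fun d => by
    refine disjoint_left.2 fun y hy hy' => ?_
    have h := hVU (subset_closure hy)
    cases d
    exacts [h.1.2 (subset_closure hy'), h.2 (subset_closure hy')]
  have hW : (f ⁻¹' (s.W ∪ U))ᶜ = (f ⁻¹' s.W)ᶜ \ f ⁻¹' U := by
    rw [preimage_union, compl_union, sdiff_eq]
  refine ⟨{ P := fun d => if d = c then insert x (s.P d) else s.P d
            V := fun d => if d = c then V ∪ s.V d else s.V d
            W := s.W ∪ U
            isOpen_V := fun d => ?_
            isOpen_W := s.isOpen_W.union hU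
            mapsTo := fun d y hy => ?_
            disjoint := ?_
            closure_subset := fun d => ?_
            irreducible := fun d y hy => ?_ }, fun d => ⟨?_, ?_⟩, x, ?_, (hS₁S hx).1⟩
  · split_ifs
    exacts [hV.union (s.isOpen_V d), s.isOpen_V d]
  · split_ifs at hy ⊢
    · rcases Finset.mem_insert.1 hy with rfl | hy
      exacts [Or.inl hxV, Or.inr (s.mapsTo d y hy)]
    · exact s.mapsTo d y hy
  · cases c
    · simpa using ⟨hdisj true, s.disjoint⟩
    · simpa using ⟨(hdisj false).symm, s.disjoint⟩
  · split_ifs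
    · rw [closure_union]
      exact union_subset (fun y hy => Or.inr (hVU hy).1.1)
        ((s.closure_subset d).trans subset_union_left)
    · exact (s.closure_subset d).trans subset_union_left
  · rw [hW]
    have hold : y ∈ s.P d → IrreducibleAt f y ((f ⁻¹' s.W)ᶜ \ f ⁻¹' U) := fun hy =>
      hPU y (by cases d <;> simp [hy])
    split_ifs at hy
    · rcases Finset.mem_insert.1 hy with rfl | hy
      · exact hirr.mono (sdiff_subset_sdiff_left fun z hz => (hS₁S hz).2)
      · exact hold hy
    · exact hold hy
  · dsimp only
    split_ifs
    exacts [Finset.subset_insert _ _, subset_rfl]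
  · dsimp only
    split_ifs
    exacts [subset_union_right, subset_rfl]
  · simp

/-- A pair in `F` is an old point, of either colour, with the colour wanted near it; irreducibility
at that point lets each request be met in turn. -/
theorem exists_extend_near [RegularSpace Y] (hf : ∀ U : Set Y, IsOpen U → IsGδ (f ⁻¹' U))
    (s : SplittingStage f) {ε : ℝ} (hε : 0 < ε) {F : Finset (X × Bool)}
    (hF : ∀ q ∈ F, ∃ d, q.1 ∈ s.P d) :
    ∃ t, s ≤ t ∧ ∀ q ∈ F, ∃ x ∈ t.P q.2, dist x q.1 ≤ ε := by
  classical
  induction F using Finset.induction_on with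
  | empty => exact ⟨s, le_rfl, by simp⟩
  | insert q F _ ih =>
    obtain ⟨t, hst, ht⟩ := ih fun r hr => hF r (Finset.mem_insert_of_mem hr)
    obtain ⟨d, hd⟩ := hF q (Finset.mem_insert_self q F)
    have hirr := t.irreducible d q.1 ((hst d).1 hd)
    obtain ⟨t', htt', x, hx, hxq⟩ := exists_extend hf t q.2 (isClosed_closedBall (x := q.1) (ε := ε))
      fun hc => hirr _ isOpen_ball (mem_ball_self hε)
        (hc.mono (inter_subset_inter_left _ ball_subset_closedBall))
    refine ⟨t', hst.trans htt', fun r hr => ?_⟩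
    rcases Finset.mem_insert.1 hr with rfl | hr
    · exact ⟨x, hx, hxq⟩
    · obtain ⟨y, hy, hyr⟩ := ht r hr
      exact ⟨y, (htt' _).1 hy, hyr⟩

theorem exists_seq [RegularSpace Y] (hf : ∀ U : Set Y, IsOpen U → IsGδ (f ⁻¹' U))
    (hn : ¬ ContinuityCovered f univ) :
    ∃ s : ℕ → SplittingStage f, Monotone s ∧ (∃ c, (s 0).P c |>.Nonempty) ∧
      ∀ n c d, ∀ p ∈ (s n).P d, ∃ x ∈ (s (n + 1)).P c, dist x p ≤ 1 / ((n : ℝ) + 1) := by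
  classical
  let e : SplittingStage f :=
    { P := fun _ => ∅
      V := fun _ => ∅
      W := ∅
      isOpen_V := fun _ => isOpen_empty
      isOpen_W := isOpen_empty
      mapsTo := by simp
      disjoint := disjoint_bot_left
      closure_subset := by simp
      irreducible := by simp }
  obtain ⟨s₀, -, x, hx, -⟩ := exists_extend hf e false isClosed_univ (by simpa [e] using hn)
  have hstep : ∀ (s : SplittingStage f) (n : ℕ), ∃ t, s ≤ t ∧
      ∀ c d, ∀ p ∈ s.P d, ∃ x ∈ t.P c, dist x p ≤ 1 / ((n : ℝ) + 1) := fun s n => by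
    obtain ⟨t, hst, ht⟩ := exists_extend_near hf s (Nat.one_div_pos_of_nat (n := n))
      (F := (s.P false ∪ s.P true) ×ˢ Finset.univ) (by
        rintro ⟨p, c⟩ hp
        rcases Finset.mem_union.1 (Finset.mem_product.1 hp).1 with h | h
        exacts [⟨_, h⟩, ⟨_, h⟩])
    exact ⟨t, hst, fun c d p hp => ht (p, c) (by cases d <;> simp [hp])⟩
  choose g hg hg' using hstep
  let s : ℕ → SplittingStage f := fun n => Nat.rec s₀ (fun n t => g t n) n
  exact ⟨s, monotone_nat_of_le_succ fun n => hg (s n) n, ⟨false, x, hx⟩, fun n => hg' (s n) n⟩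

end SplittingStage

theorem exists_disjoint_dense_preimages {X Y : Type*} [PseudoMetricSpace X] [TopologicalSpace Y]
    [RegularSpace Y] {f : X → Y} (hf : ∀ U : Set Y, IsOpen U → IsGδ (f ⁻¹' U))
    (hn : ¬ ContinuityCovered f univ) :
    ∃ (K : Set X) (V : Bool → Set Y), IsClosed K ∧ K.Nonempty ∧ (∀ c, IsOpen (V c)) ∧
      Disjoint (V false) (V true) ∧ ∀ c, K ⊆ closure (K ∩ f ⁻¹' V c) := by
  obtain ⟨s, hs, ⟨c₀, x₀, hx₀⟩, hnear⟩ := SplittingStage.exists_seq hf hn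
  let Q : Set X := ⋃ n, ⋃ c, ((s n).P c : Set X)
  refine ⟨closure Q, fun c => ⋃ n, (s n).V c, isClosed_closure,
    ⟨x₀, subset_closure (mem_iUnion₂.2 ⟨0, c₀, hx₀⟩)⟩,
    fun c => isOpen_iUnion fun n => (s n).isOpen_V c, ?_, fun c => ?_⟩
  · refine disjoint_iUnion_left.2 fun n => disjoint_iUnion_right.2 fun m => ?_
    exact (s (max n m)).disjoint.mono (hs (le_max_left n m) _).2 (hs (le_max_right n m) _).2
  · refine closure_minimal (fun p hp => ?_) isClosed_closure
    obtain ⟨n, d, hp⟩ := mem_iUnion₂.1 hp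
    refine Metric.mem_closure_iff.2 fun ε hε => ?_
    obtain ⟨m, hm⟩ := exists_nat_one_div_lt hε
    -- Stage `max n m` is late enough both to contain `p` and to give precision `ε`.
    obtain ⟨x, hx, hxp⟩ := hnear (max n m) c d p ((hs (le_max_left n m) _).1 hp)
    refine ⟨x, ⟨subset_closure (mem_iUnion₂.2 ⟨_, c, hx⟩),
      mem_iUnion.2 ⟨_, (s _).mapsTo c x hx⟩⟩, ?_⟩
    rw [dist_comm]
    refine (hxp.trans (Nat.one_div_le_one_div (le_max_right n m))).trans_lt hm

/-! ### Baire category arguments and the equivalence -/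

theorem PiTwoMeasurable.piecewiseContinuous {X : Type u} {Y : Type v} [PseudoMetricSpace X]
    [TopologicalSpace Y] [RegularSpace Y] (hX : CompletelyBaire X) {f : X → Y}
    (hf : PiTwoMeasurable f) : PiecewiseContinuous f := by
  by_cases hn : ContinuityCovered f univ
  · obtain ⟨C, h1, h2, h3⟩ := hn
    exact ⟨C, h1, univ_subset_iff.1 h2, h3⟩
  obtain ⟨K, V, hK, hne, hV, hdisj, hdense⟩ := exists_disjoint_dense_preimages hf hn
  have := hX K hK
  have : Nonempty K := hne.to_subtype
  have hG : ∀ c, IsGδ ((↑) ⁻¹' (f ⁻¹' V c) : Set K) := fun c =>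
    (hf _ (hV c)).preimage continuous_subtype_val
  have hD : ∀ c, Dense ((↑) ⁻¹' (f ⁻¹' V c) : Set K) := fun c => by
    rw [Subtype.dense_iff, Subtype.image_preimage_coe]
    exact hdense c
  obtain ⟨x, hx, hx'⟩ := ((hD false).inter_of_Gδ (hG false) (hG true) (hD true)).nonempty
  exact (disjoint_left.1 hdisj hx hx').elim

theorem PiecewiseContinuous.resolvableMeasurable {X : Type u} {Y : Type v} [TopologicalSpace X]
    [TopologicalSpace Y] (hX : CompletelyBaire X) {f : X → Y} (hf : PiecewiseContinuous f) :
    ResolvableMeasurable f := by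
  obtain ⟨C, hC, hcov, hcont⟩ := hf
  intro U hU
  refine isResolvableSet_of_forall_isClosed fun A hA hne => ?_
  have := hX A hA
  have : Nonempty A := hne.to_subtype
  obtain ⟨n, x, hx⟩ := nonempty_interior_of_iUnion_of_closed
    (f := fun n => ((↑) ⁻¹' C n : Set A)) (fun n => (hC n).preimage continuous_subtype_val)
    (by rw [← preimage_iUnion, hcov, preimage_univ])
  obtain ⟨O', hO'C, hO', hxO⟩ := mem_interior.1 hx
  obtain ⟨O, hO, rfl⟩ := isOpen_induced_iff.1 hO'
  have hOA : O ∩ A ⊆ C n := fun y hy => hO'C (a := ⟨y, hy.2⟩) hy.1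
  by_cases h : ∃ y ∈ O ∩ A, f y ∈ U
  · obtain ⟨y, hy, hyU⟩ := h
    obtain ⟨u, hu, hfu⟩ := continuousOn_iff'.1 (hcont n) U hU
    have hyu : y ∈ u ∩ C n := hfu ▸ ⟨hyU, hOA hy⟩
    refine ⟨O ∩ u, hO.inter hu, ⟨y, ⟨hy.1, hyu.1⟩, hy.2⟩, Or.inl fun z hz => ?_⟩
    have hz' : z ∈ f ⁻¹' U ∩ C n := hfu ▸ ⟨hz.1.2, hOA ⟨hz.1.1, hz.2⟩⟩
    exact hz'.1
  · exact ⟨O, hO, ⟨x, hxO, x.2⟩, Or.inr fun y hy hyU => h ⟨y, hy, hyU⟩⟩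

theorem theorem6 {X : Type u} {Y : Type v} [TopologicalSpace X] [TopologicalSpace.MetrizableSpace X]
    [TopologicalSpace Y] [RegularSpace Y] (hX : CompletelyBaire X) (f : X → Y) :
    List.TFAE [ResolvableMeasurable f, PiecewiseContinuous f, PiTwoMeasurable f] := by
  let _ := TopologicalSpace.metrizableSpaceMetric X
  tfae_have 1 → 3 := fun h U hU => (h U hU).isGδ
  tfae_have 3 → 2 := fun h => h.piecewiseContinuous hX
  tfae_have 2 → 1 := fun h => h.resolvableMeasurable hX
  tfae_finish
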